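/- **Theorem 2.1.** Let $M$ be a connected Kähler manifold of real dimension $4$, with metric $g$ and complex structure $J$. Let $R$ be its curvature tensor, $R(x,y)=\nabla_x\nabla_y-\nabla_y\nabla_x-\nabla_{[x,y]}$, let $S$ be its Ricci tensor, where $S(y,z)$ is the trace of $x\mapsto R(x,y)z$ and $g(Sx,y)=S(x,y)$, and let $\tau=\operatorname{tr}S$ be its scalar curvature. Let $B$ be the Bochner curvature tensor, which on a Kähler manifold of real dimension $2n$ is the tensor field of type $(1,3)$ $$ \begin{aligned} B(x,y)z ={}& R(x,y)z-\frac{1}{2(n+2)}\Big\{S(y,z)x-S(x,z)y+g(y,z)Sx-g(x,z)Sy\\ &+S(Jy,z)Jx-S(Jx,z)Jy+g(Jy,z)SJx-g(Jx,z)SJy-2S(Jx,y)Jz-2g(Jx,y)SJz\Big\}\\ &+\frac{\tau}{4(n+1)(n+2)}\Big\{g(y,z)x-g(x,z)y+g(Jy,z)Jx-g(Jx,z)Jy-2g(Jx,y)Jz\Big\} \end{aligned} $$ (here $n=2$). Suppose that $B$ is nonvanishing, that is, $B_p\neq 0$ at every point $p\in M$. Let $f:M\to M$ be a holomorphic transformation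 (a bijection such that $f$ and $f^{-1}$ are holomorphic) which preserves $B$, that is, $$f_*\big(B(x,y)z\big)=B(f_*x,f_*y)f_*z\qquad\text{for all } p\in M,\ x,y,z\in T_pM.$$ Then $f$ is a homothety: there is a constant $c>0$ such that $f^*g=c\,g$ on $M$. -/

import Mathlib

set_option maxSynthPendingDepth 3

open scoped Manifold ContDiff

noncomputable section

namespace Kahler

/-- A complex manifold is in particular a real analytic manifold: holomorphic transition maps are
real analytic. -/
instance isManifold_real_of_complex {E : Type*} [NormedAddCommGroup E] [NormedSpace ℂ E]
    {M : Type*} [TopologicalSpace M] [ChartedSpace E M] [IsManifold 𝓘(ℂ, E) ω M] :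
    IsManifold 𝓘(ℝ, E) ω M := by
  refine isManifold_of_contDiffOn 𝓘(ℝ, E) ω M fun e e' he he' => ?_
  have h := (contDiffGroupoid ω 𝓘(ℂ, E)).compatible he he'
  rw [contDiffGroupoid, mem_groupoid_of_pregroupoid] at h
  exact h.1.restrict_scalars ℝ

/-- Multiplication by `i` on a complex vector space, as a real endomorphism. -/
def cJ (E : Type*) [NormedAddCommGroup E] [NormedSpace ℂ E] : E →L[ℝ] E :=
  Complex.I • ContinuousLinearMap.id ℝ E

/-- The complex structure `J` of a complex manifold, on the tangent space at `p`. The tangent space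
is identified with `E` by the derivative of the holomorphic chart at `p`, so `J` is multiplication
by `i`. -/
def complexStructure {E : Type*} [NormedAddCommGroup E] [NormedSpace ℂ E]
    {M : Type*} [TopologicalSpace M] [ChartedSpace E M] (p : M) :
    TangentSpace 𝓘(ℝ, E) p →L[ℝ] TangentSpace 𝓘(ℝ, E) p :=
  cJ E

/-- A smooth Riemannian metric on the tangent bundle of the real manifold underlying the complex
manifold `M`. -/
abbrev RiemMetric (E : Type*) [NormedAddCommGroup E] [NormedSpace ℂ E]
    (M : Type*) [TopologicalSpace M] [ChartedSpace E M] [IsManifold 𝓘(ℂ, E) ω M] :=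
  Bundle.ContMDiffRiemannianMetric 𝓘(ℝ, E) ∞ E (fun p : M => TangentSpace 𝓘(ℝ, E) p)

section

variable {E : Type*} [NormedAddCommGroup E] [NormedSpace ℂ E]
  {M : Type*} [TopologicalSpace M] [ChartedSpace E M] [IsManifold 𝓘(ℂ, E) ω M]

/-- The metric as a real bilinear form on `E`, the tangent space at `p`. -/
def metricAt (g : RiemMetric E M) (p : M) : E →L[ℝ] E →L[ℝ] ℝ :=
  g.inner p

/-- The metric in the chart at `p`: its pullback under the inverse of that chart, a field of
bilinear forms on the chart's target. -/
def localMetric (g : RiemMetric E M) (p : M) (y : E) : E →L[ℝ] E →L[ℝ] ℝ :=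
  let T : E →L[ℝ] E := mfderiv 𝓘(ℝ, E) 𝓘(ℝ, E) (extChartAt 𝓘(ℝ, E) p).symm y
  (metricAt g ((extChartAt 𝓘(ℝ, E) p).symm y)).bilinearComp T T

/-- The Christoffel symbols in the chart at `p`, where `G` is the metric in that chart:
`G (Γ u v) w = (1/2) (∂_u G (v, w) + ∂_v G (u, w) - ∂_w G (u, v))`. -/
def christoffel (g : RiemMetric E M) (p : M) (y : E) : E →L[ℝ] E →L[ℝ] E :=
  let D : E →L[ℝ] E →L[ℝ] E →L[ℝ] ℝ := fderiv ℝ (localMetric g p) y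
  let D' : E →L[ℝ] E →L[ℝ] E →L[ℝ] ℝ :=
    ((ContinuousLinearMap.flipₗᵢ ℝ E E ℝ : (E →L[ℝ] E →L[ℝ] ℝ) →L[ℝ] (E →L[ℝ] E →L[ℝ] ℝ))).comp
      D.flip
  let K : E →L[ℝ] E →L[ℝ] E →L[ℝ] ℝ := D + D.flip - D'
  (1 / 2 : ℝ) •
    (ContinuousLinearMap.compL ℝ E (E →L[ℝ] ℝ) E (localMetric g p y).inverse).comp K

/-- The Riemann curvature tensor at `p`, computed in the chart at `p`, with the convention
`R(u, v) = ∇_u ∇_v - ∇_v ∇_u - ∇_[u, v]`; see `curvature_apply`. -/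
def curvature (g : RiemMetric E M) (p : M) : E →L[ℝ] E →L[ℝ] E →L[ℝ] E :=
  let y : E := extChartAt 𝓘(ℝ, E) p p
  let A : E →L[ℝ] E →L[ℝ] E →L[ℝ] E := fderiv ℝ (christoffel g p) y
  let Q : E →L[ℝ] E →L[ℝ] E →L[ℝ] E :=
    (ContinuousLinearMap.compL ℝ E E E).bilinearComp (christoffel g p y) (christoffel g p y)
  A - A.flip + (Q - Q.flip)

theorem christoffel_apply (g : RiemMetric E M) (p : M) (y u v : E) :
    christoffel g p y u v = (1 / 2 : ℝ) • (localMetric g p y).inverse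
      (fderiv ℝ (localMetric g p) y u v + fderiv ℝ (localMetric g p) y v u
        - ((fderiv ℝ (localMetric g p) y).flip u).flip v) := rfl

theorem curvature_apply (g : RiemMetric E M) (p : M) (u v w : E) :
    curvature g p u v w =
      fderiv ℝ (christoffel g p) (extChartAt 𝓘(ℝ, E) p p) u v w
        - fderiv ℝ (christoffel g p) (extChartAt 𝓘(ℝ, E) p p) v u w
        + (christoffel g p (extChartAt 𝓘(ℝ, E) p p) u
              (christoffel g p (extChartAt 𝓘(ℝ, E) p p) v w)
          - christoffel g p (extChartAt 𝓘(ℝ, E) p p) v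
              (christoffel g p (extChartAt 𝓘(ℝ, E) p p) u w)) := rfl

/-- `g` is a Kähler metric: it is Hermitian, `g(Jv, Jw) = g(v, w)`, and its fundamental form
`Ω(v, w) = g(Jv, w)` is closed. The condition `dΩ = 0` is written out on the domain of each
holomorphic chart, in which `J` is the constant multiplication by `i`:
`dΩ(u, v, w) = ∂_u Ω(v, w) + ∂_v Ω(w, u) + ∂_w Ω(u, v)`. -/
structure IsKahler (g : RiemMetric E M) : Prop where
  hermitian : ∀ (p : M) (v w : TangentSpace 𝓘(ℝ, E) p),
    g.inner p (complexStructure p v) (complexStructure p w) = g.inner p v w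
  closed : ∀ (p : M), ∀ y ∈ (extChartAt 𝓘(ℝ, E) p).target, ∀ u v w : E,
    fderiv ℝ (localMetric g p) y u (cJ E v) w
      + fderiv ℝ (localMetric g p) y v (cJ E w) u
      + fderiv ℝ (localMetric g p) y w (cJ E u) v = 0

/-- The map `f` is a homothety: `f^* g = c g` for a positive constant `c`. -/
def IsHomothety (g : RiemMetric E M) (f : M → M) : Prop :=
  ∃ c : ℝ, 0 < c ∧ ∀ (p : M) (v w : TangentSpace 𝓘(ℝ, E) p),
    g.inner (f p) (mfderiv 𝓘(ℝ, E) 𝓘(ℝ, E) f p v) (mfderiv 𝓘(ℝ, E) 𝓘(ℝ, E) f p w) =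
      c * g.inner p v w

variable [FiniteDimensional ℂ E]

/-- The Ricci tensor of type `(0,2)`: `S(v, w)` is the trace of `u ↦ R(u, v) w`. -/
def ricci (g : RiemMetric E M) (p : M) : E →L[ℝ] E →L[ℝ] ℝ :=
  LinearMap.toContinuousLinearMap
    (LinearMap.toContinuousLinearMap.toLinearMap ∘ₗ
      LinearMap.mk₂ ℝ
        (fun v w : E => LinearMap.trace ℝ E (((curvature g p).flip v).flip w).toLinearMap)
        (fun v v' w => by
          rw [← map_add]; congr 1; ext u; simp)
        (fun c v w => by
          rw [← map_smul]; congr 1; ext u; simp)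
        (fun v w w' => by
          rw [← map_add]; congr 1; ext u; simp)
        (fun c v w => by
          rw [← map_smul]; congr 1; ext u; simp))

theorem ricci_apply (g : RiemMetric E M) (p : M) (v w : E) :
    ricci g p v w = LinearMap.trace ℝ E (((curvature g p).flip v).flip w).toLinearMap := rfl

/-- The Ricci tensor of type `(1,1)`: `g(S v, w) = S(v, w)`. -/
def ricciOp (g : RiemMetric E M) (p : M) : E →L[ℝ] E :=
  (metricAt g p).inverse.comp (ricci g p)

/-- The scalar curvature, the trace of the Ricci tensor. -/
def scalarCurv (g : RiemMetric E M) (p : M) : ℝ :=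
  LinearMap.trace ℝ E (ricciOp g p).toLinearMap

/-- The Bochner curvature tensor `B(x, y) z` of type `(1,3)` at `p`, for a manifold of complex
dimension `n`. -/
def bochner (g : RiemMetric E M) (p : M) (x y z : TangentSpace 𝓘(ℝ, E) p) :
    TangentSpace 𝓘(ℝ, E) p :=
  let n : ℝ := Module.finrank ℂ E
  let R : E → E → E → E := fun u v w => curvature g p u v w
  let s : E → E → ℝ := fun u v => ricci g p u v
  let S : E → E := ricciOp g p
  let τ : ℝ := scalarCurv g p
  let m : E → E → ℝ := fun u v => metricAt g p u v
  let J : E → E := cJ E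
  let B : E → E → E → E := fun x y z =>
    R x y z
      - (1 / (2 * (n + 2))) •
          (s y z • x - s x z • y + m y z • S x - m x z • S y
            + s (J y) z • J x - s (J x) z • J y + m (J y) z • S (J x) - m (J x) z • S (J y)
            - (2 * s (J x) y) • J z - (2 * m (J x) y) • S (J z))
      + (τ / (4 * (n + 1) * (n + 2))) •
          (m y z • x - m x z • y + m (J y) z • J x - m (J x) z • J y - (2 * m (J x) y) • J z)
  B x y z

/-- The Bochner tensor vanishes nowhere: at every point it is a nonzero tensor. -/
def BochnerNonvanishing (g : RiemMetric E M) : Prop :=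
  ∀ p : M, ∃ x y z : TangentSpace 𝓘(ℝ, E) p, bochner g p x y z ≠ 0

/-- The map `f` preserves the Bochner tensor of type `(1,3)`:
`f_* (B(x, y) z) = B(f_* x, f_* y) f_* z`. -/
def PreservesBochner (g : RiemMetric E M) (f : M → M) : Prop :=
  ∀ (p : M) (x y z : TangentSpace 𝓘(ℝ, E) p),
    mfderiv 𝓘(ℝ, E) 𝓘(ℝ, E) f p (bochner g p x y z) =
      bochner g (f p) (mfderiv 𝓘(ℝ, E) 𝓘(ℝ, E) f p x) (mfderiv 𝓘(ℝ, E) 𝓘(ℝ, E) f p y)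
        (mfderiv 𝓘(ℝ, E) 𝓘(ℝ, E) f p z)

end

end Kahler

end

/-!
The proof is pointwise linear algebra followed by one use of `dω = 0`.

At a point, the Bochner tensor `B` of a Kähler surface is an algebraic curvature tensor: it
satisfies the Bianchi identity, is skew for the metric and commutes with `J`
(`isKahlerCurvature_bochner`), and its Ricci contraction vanishes (`sum_metricAt_bochner`). Since
the differential of `f` is complex linear and carries `B` to `B`, the tensor `B` at `p` is skew
for two Hermitian forms, `g` and `f^* g`. If these were not proportional, `B` would preserve two
orthogonal complex lines. The Bianchi identity and pair symmetry would leave only the two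
sectional curvatures of these lines, which are Ricci curvatures, hence zero
(`IsKahlerCurvature.proportional_or_eq_zero`). As `B ≠ 0`, this gives `f^* g = c g` for a positive
function `c` (`exists_conformal_factor`).

The fundamental forms of `g` and `f^* g = c g` are both closed, so `dc ∧ ω = 0`. In complex
dimension two this forces `dc = 0`, so `c` is locally constant (`eventually_conformal_factor_eq`),
and constant because the manifold is connected.

The symmetries of the curvature tensor come from the properties of the Christoffel symbols in a
holomorphic chart, where `J` is constant: they are symmetric, metric, and commute with `J`
(`christoffel_symm`, `fderiv_localMetric_eq`, `christoffel_J`).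
-/

noncomputable section

namespace Kahler

/-! ### Hermitian forms and algebraic curvature tensors -/

section HermitianAlgebra

variable {E : Type*} [NormedAddCommGroup E] [NormedSpace ℂ E]

theorem cJ_cJ (v : E) : cJ E (cJ E v) = -v := by
  simp [cJ, smul_smul]

theorem complex_smul_eq (c : ℂ) (v : E) : c • v = c.re • v + c.im • cJ E v := by
  have h : cJ E v = Complex.I • v := rfl
  rw [h, RCLike.real_smul_eq_coe_smul (K := ℂ) c.re, RCLike.real_smul_eq_coe_smul (K := ℂ) c.im,
    smul_smul, ← add_smul]
  congr 1
  exact (Complex.re_add_im c).symm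

/-- A positive definite symmetric real bilinear form, invariant under multiplication by `i`: the
real part of a Hermitian inner product on `E`. -/
structure IsHermitianForm (m : E →L[ℝ] E →L[ℝ] ℝ) : Prop where
  symm : ∀ v w, m v w = m w v
  pos : ∀ v, v ≠ 0 → 0 < m v v
  inv : ∀ v w, m (cJ E v) (cJ E w) = m v w

/-- The algebraic identities satisfied by the curvature tensor of a Kähler metric at a point, for
a tensor `T` of type `(1,3)` and the form `m`. -/
structure IsKahlerCurvature (m : E →L[ℝ] E →L[ℝ] ℝ) (T : E → E → E → E) : Prop where
  linear : ∀ x y, IsLinearMap ℝ (T x y)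
  skew : ∀ x y z, T x y z = -T y x z
  bianchi : ∀ x y z, T x y z + T y z x + T z x y = 0
  metric_skew : ∀ x y z w, m (T x y z) w = -m (T x y w) z
  comm_J : ∀ x y z, T x y (cJ E z) = cJ E (T x y z)

namespace IsHermitianForm

variable {m h : E →L[ℝ] E →L[ℝ] ℝ}

theorem J_left (hm : IsHermitianForm m) (v w : E) : m (cJ E v) w = -m v (cJ E w) := by
  have := hm.inv v (cJ E w)
  rw [cJ_cJ, map_neg] at this
  linarith

theorem J_self (hm : IsHermitianForm m) (v : E) : m (cJ E v) v = 0 := by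
  have := hm.J_left v v
  rw [hm.symm v] at this
  linarith

theorem self_J (hm : IsHermitianForm m) (v : E) : m v (cJ E v) = 0 := by
  rw [hm.symm, hm.J_self]

theorem eq_zero (hm : IsHermitianForm m) {v : E} (hv : m v v = 0) : v = 0 := by
  by_contra h
  exact (hm.pos v h).ne' hv

theorem eq_of_forall (hm : IsHermitianForm m) {u v : E} (h : ∀ w, m u w = m v w) : u = v := by
  have h1 : m u = m v := by ext w; exact h w
  refine sub_eq_zero.1 (hm.eq_zero ?_)
  rw [map_sub m, h1, sub_self, zero_apply]

theorem exists_unit (hm : IsHermitianForm m) {v : E} (hv : v ≠ 0) :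
    ∃ c : ℝ, m (c • v) (c • v) = 1 := by
  have h := hm.pos v hv
  refine ⟨(Real.sqrt (m v v))⁻¹, ?_⟩
  simp only [map_smul, smul_apply, smul_eq_mul]
  rw [← mul_assoc, ← mul_inv, Real.mul_self_sqrt h.le, inv_mul_cancel₀ h.ne']

/-- In real dimension four, some unit vector is orthogonal to the complex line spanned by `v`. The
case `v = 0` gives the existence of a unit vector. -/
theorem exists_unit_orthogonal [FiniteDimensional ℂ E] (hm : IsHermitianForm m)
    (hdim : Module.finrank ℝ E = 4) (v : E) :
    ∃ w, m w w = 1 ∧ m v w = 0 ∧ m (cJ E v) w = 0 := by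
  let φ : E →ₗ[ℝ] ℝ × ℝ := (m v).toLinearMap.prod (m (cJ E v)).toLinearMap
  have : FiniteDimensional ℝ E := FiniteDimensional.complexToReal E
  have hk : LinearMap.ker φ ≠ ⊥ := LinearMap.ker_ne_bot_of_finrank_lt (by simp [hdim])
  obtain ⟨w, hw, hw0⟩ := Submodule.exists_mem_ne_zero_of_ne_bot hk
  obtain ⟨c, hc1⟩ := hm.exists_unit hw0
  have h2 : m v w = 0 ∧ m (cJ E v) w = 0 := by simpa [φ] using hw
  exact ⟨c • w, hc1, by simp [h2.1], by simp [h2.2]⟩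

/-- The orthonormal real basis `v, Jv, w, Jw` attached to a unitary pair `v, w`. -/
theorem exists_basis [FiniteDimensional ℂ E] (hm : IsHermitianForm m)
    (hdim : Module.finrank ℝ E = 4) {v w : E} (hv : m v v = 1) (hw : m w w = 1)
    (hvw : m v w = 0) (hJvw : m (cJ E v) w = 0) :
    ∃ b : Module.Basis (Fin 4) ℝ E, ⇑b = ![v, cJ E v, w, cJ E w] ∧
      ∀ i j, m (b i) (b j) = if i = j then 1 else 0 := by
  have hvJ : m v (cJ E w) = 0 := by rw [← neg_eq_zero, ← hm.J_left, hJvw]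
  have ho : ∀ i j, m (![v, cJ E v, w, cJ E w] i) (![v, cJ E v, w, cJ E w] j)
      = if i = j then 1 else 0 := by
    intro i j
    fin_cases i <;> fin_cases j <;>
      simp [hv, hw, hvw, hJvw, hvJ, hm.J_self, hm.self_J, hm.inv, hm.symm w, hm.symm (cJ E w)]
  have hli : LinearIndependent ℝ ![v, cJ E v, w, cJ E w] := by
    rw [Fintype.linearIndependent_iff]
    intro c hc i
    have := congrArg (m (![v, cJ E v, w, cJ E w] i)) hc
    simpa only [map_sum, map_smul, ho, smul_eq_mul, mul_ite, mul_one, mul_zero,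
      Finset.sum_ite_eq, Finset.mem_univ, if_true, map_zero] using this
  refine ⟨basisOfLinearIndependentOfCardEqFinrank hli (by simp [hdim]), by simp, ?_⟩
  intro i j
  simpa using ho i j

/-- The trace of an endomorphism in an orthonormal basis. -/
theorem _root_.Kahler.trace_eq_sum {m : E →L[ℝ] E →L[ℝ] ℝ} {ι : Type*} [Fintype ι] [DecidableEq ι]
    (b : Module.Basis ι ℝ E) (hb : ∀ i j, m (b i) (b j) = if i = j then 1 else 0)
    (A : E →ₗ[ℝ] E) : LinearMap.trace ℝ E A = ∑ i, m (A (b i)) (b i) := by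
  rw [LinearMap.trace_eq_matrix_trace ℝ b, Matrix.trace]
  refine Finset.sum_congr rfl fun i _ => ?_
  rw [Matrix.diag_apply, LinearMap.toMatrix_apply]
  conv_rhs => rw [← b.sum_repr (A (b i))]
  simp only [map_sum, map_smul, sum_apply, smul_apply, hb,
    smul_eq_mul, mul_ite, mul_one, mul_zero, Finset.sum_ite_eq', Finset.mem_univ, if_true]

theorem exists_orthonormal_basis [FiniteDimensional ℂ E] (hm : IsHermitianForm m)
    (hdim : Module.finrank ℝ E = 4) : ∃ b : Module.Basis (Fin 4) ℝ E,
      ∀ i j, m (b i) (b j) = if i = j then 1 else 0 := by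
  obtain ⟨v, hv, -⟩ := hm.exists_unit_orthogonal hdim 0
  obtain ⟨w, hw, h1, h2⟩ := hm.exists_unit_orthogonal hdim v
  obtain ⟨b, -, hb⟩ := hm.exists_basis hdim hv hw h1 h2
  exact ⟨b, hb⟩

theorem isInvertible [FiniteDimensional ℂ E] (hm : IsHermitianForm m) : m.IsInvertible := by
  have : FiniteDimensional ℝ E := FiniteDimensional.complexToReal E
  have hinj : Function.Injective m := by
    rw [injective_iff_map_eq_zero]
    intro v hv
    exact hm.eq_zero (by simp [hv])
  have hfr : Module.finrank ℝ E = Module.finrank ℝ (E →L[ℝ] ℝ) := by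
    rw [← LinearEquiv.finrank_eq (LinearMap.toContinuousLinearMap (𝕜 := ℝ) (E := E) (F' := ℝ))]
    exact (Subspace.dual_finrank_eq (K := ℝ) (V := E)).symm
  let e : E ≃ₗ[ℝ] (E →L[ℝ] ℝ) := LinearEquiv.ofInjectiveOfFinrankEq m.toLinearMap hinj hfr
  refine ⟨e.toContinuousLinearEquiv, ?_⟩
  ext v w
  rfl

theorem apply_inverse [FiniteDimensional ℂ E] (hm : IsHermitianForm m) (φ : E →L[ℝ] ℝ) :
    m (m.inverse φ) = φ := by
  obtain ⟨e, he⟩ := hm.isInvertible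
  rw [← he, ContinuousLinearMap.inverse_equiv]
  exact e.apply_symm_apply φ

/-- A second Hermitian form has an eigenvector with respect to `m`. The eigenvalue, a priori a
complex number `a + bi`, is real since both forms vanish on `(v, Jv)`. -/
theorem exists_eigenvector [FiniteDimensional ℂ E] [Nontrivial E] (hm : IsHermitianForm m)
    (hh : IsHermitianForm h) : ∃ (v : E) (a : ℝ), m v v = 1 ∧ ∀ w, h v w = a * m v w := by
  let P : E →L[ℝ] E := m.inverse.comp h
  have hP : ∀ v w, m (P v) w = h v w := fun v w => by
    change m (m.inverse (h v)) w = h v w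
    rw [hm.apply_inverse]
  have hPJ : ∀ v, P (cJ E v) = cJ E (P v) := fun v => by
    refine hm.eq_of_forall fun u => ?_
    rw [hP, hm.J_left, hP, hh.J_left]
  -- `Q` is `P` as a complex linear endomorphism
  let Q : Module.End ℂ E :=
    { toFun := P
      map_add' := map_add P
      map_smul' := fun c v => by
        rw [complex_smul_eq, map_add, map_smul, map_smul, hPJ]
        exact (complex_smul_eq c (P v)).symm }
  obtain ⟨μ, hμ⟩ := Module.End.exists_eigenvalue Q
  obtain ⟨v, hv, hv0⟩ := hμ.exists_hasEigenvector
  have hv1 : P v = μ.re • v + μ.im • cJ E v := by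
    have : P v = μ • v := Module.End.mem_eigenspace_iff.1 hv
    rw [this, complex_smul_eq]
  have him : μ.im = 0 := by
    have h1 := hP v (cJ E v)
    rw [hv1, hh.self_J] at h1
    simp only [map_add, map_smul, add_apply, smul_apply,
      hm.self_J, hm.inv, smul_eq_mul, mul_zero, zero_add] at h1
    exact (mul_eq_zero.1 h1).resolve_right (hm.pos v hv0).ne'
  obtain ⟨c, hc⟩ := hm.exists_unit hv0
  refine ⟨c • v, μ.re, hc, fun w => ?_⟩
  rw [map_smul, map_smul, smul_apply, smul_apply, ← hP, hv1, him]
  simp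
  ring

end IsHermitianForm

namespace IsKahlerCurvature

variable {m h : E →L[ℝ] E →L[ℝ] ℝ} {T : E → E → E → E}

theorem pair_symm (hT : IsKahlerCurvature m T) (x y z w : E) :
    m (T x y z) w = m (T z w x) y := by
  have B : ∀ a b c d, m (T a b c) d + m (T b c a) d + m (T c a b) d = 0 := fun a b c d => by
    rw [← add_apply, ← add_apply, ← map_add, ← map_add,
      hT.bianchi]
    simp
  have S : ∀ a b c d, m (T a b c) d = -m (T b a c) d := fun a b c d => by
    rw [hT.skew]; simp
  have K := hT.metric_skew
  -- sum of the Bianchi identities for the four cyclic arrangements of `x, y, z, w`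
  linarith [B x y z w, B y z w x, B z w x y, B w x y z, S x y z w, S z w x y, K x y z w,
    K y z x w, K z x y w, K y z w x, K z w y x, K w y z x, K z w x y, K w x z y, K x z w y,
    K w x y z, K x y w z, K y w x z, S y z x w, S z x y w, S x z y w, S y w x z, S w y x z,
    S w y z x, S x z w y]

/-- By pair symmetry, commuting with `J` in the third slot gives invariance in the first two. -/
theorem apply_J_J (hT : IsKahlerCurvature m T) (hm : IsHermitianForm m) (x y z : E) :
    T (cJ E x) (cJ E y) z = T x y z := by
  refine hm.eq_of_forall fun u => ?_
  rw [hT.pair_symm, hT.comm_J, hm.inv, hT.pair_symm x]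

/-- Suppose a curvature tensor in real dimension four is skew for two Hermitian forms and
Ricci-flat. If the forms are not proportional, the tensor preserves two orthogonal complex lines.
The Bianchi identity and pair symmetry then leave only the two sectional curvatures of these lines,
which are Ricci curvatures, so the tensor vanishes. -/
theorem proportional_or_eq_zero [FiniteDimensional ℂ E] (hT : IsKahlerCurvature m T)
    (hm : IsHermitianForm m) (hh : IsHermitianForm h) (hdim : Module.finrank ℝ E = 4)
    (hTh : ∀ x y z w, h (T x y z) w = -h (T x y w) z)
    (hric : ∀ (b : Module.Basis (Fin 4) ℝ E),
      (∀ i j, m (b i) (b j) = if i = j then 1 else 0) →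
      ∀ y z, ∑ i, m (T (b i) y z) (b i) = 0) :
    (∃ c : ℝ, 0 < c ∧ ∀ v w, h v w = c * m v w) ∨ ∀ x y z, T x y z = 0 := by
  have : FiniteDimensional ℝ E := FiniteDimensional.complexToReal E
  have : Nontrivial E := Module.nontrivial_of_finrank_pos (R := ℝ) (by omega)
  obtain ⟨v, a, hv, hva⟩ := hm.exists_eigenvector hh
  obtain ⟨w, hw, hvw, hJvw⟩ := hm.exists_unit_orthogonal hdim v
  obtain ⟨b, hb, hbo⟩ := hm.exists_basis hdim hv hw hvw hJvw
  have hvJw : m v (cJ E w) = 0 := by rw [← neg_eq_zero, ← hm.J_left, hJvw]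
  -- every vector is determined by its four components
  have hext : ∀ u, m u v = 0 → m u (cJ E v) = 0 → m u w = 0 → m u (cJ E w) = 0 → u = 0 := by
    intro u h1 h2 h3 h4
    have : m u = 0 := by
      have := b.ext (f₁ := (m u).toLinearMap) (f₂ := 0) (by
        intro i
        rw [hb]
        fin_cases i <;> simp [h1, h2, h3, h4])
      ext x
      exact LinearMap.congr_fun this x
    exact hm.eq_zero (by simp [this])
  have hlin : ∀ (φ : E → E), IsLinearMap ℝ φ → φ v = 0 → φ (cJ E v) = 0 → φ w = 0 →
      φ (cJ E w) = 0 → ∀ x, φ x = 0 := by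
    intro φ hφ h1 h2 h3 h4 x
    have := b.ext (f₁ := hφ.mk' φ) (f₂ := 0) (by
      intro i
      rw [hb]
      fin_cases i <;> simp [h1, h2, h3, h4])
    exact LinearMap.congr_fun this x
  set d := h w w with hd
  -- `w` is an eigenvector too, being orthogonal to the complex line of `v`
  have hwd : ∀ u, h u w = d * m u w := by
    have h1 : h v w = 0 := by rw [hva, hvw, mul_zero]
    have h2 : h (cJ E v) w = 0 := by rw [hh.J_left, hva, hvJw, mul_zero, neg_zero]
    intro u
    have := b.ext (f₁ := (h.flip w).toLinearMap) (f₂ := d • (m.flip w).toLinearMap) (by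
      intro i
      rw [hb]
      fin_cases i <;> simp [h1, h2, hvw, hJvw, hw, hd, hh.J_self, hm.J_self])
    exact LinearMap.congr_fun this u
  have hwdJ : ∀ u, h u (cJ E w) = d * m u (cJ E w) := by
    intro u
    have := hwd (cJ E u)
    rw [hh.J_left, hm.J_left] at this
    linarith
  by_cases had : a = d
  · left
    refine ⟨a, ?_, ?_⟩
    · have hv0 : v ≠ 0 := by rintro rfl; simp at hv
      have := hh.pos v hv0
      rwa [hva, hv, mul_one] at this
    · intro x y
      have := b.ext (f₁ := (h.flip y).toLinearMap) (f₂ := a • (m.flip y).toLinearMap) (by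
        intro i
        rw [hb]
        fin_cases i
        · simp [hva]
        · simp [hh.J_left, hm.J_left, hva]
        · simp [hh.symm w, hm.symm w, hwd, had]
        · simp [hh.symm _ y, hm.symm _ y, hwdJ, had])
      exact LinearMap.congr_fun this x
  · right
    -- `T x y` maps the complex line of `v` to itself, and likewise for `w`
    have hcross : ∀ x y, m (T x y v) w = 0 := by
      intro x y
      have h1 := hTh x y v w
      rw [hwd, hh.symm _ v, hva, hm.symm v, hT.metric_skew x y w v] at h1
      have h2 : (d - a) * m (T x y v) w = 0 := by linear_combination h1
      exact (mul_eq_zero.1 h2).resolve_left (sub_ne_zero.2 (Ne.symm had))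
    have hcross' : ∀ x y, m (T x y w) v = 0 := fun x y => by
      rw [hT.metric_skew, hcross, neg_zero]
    have hJl : ∀ x y p q, m (T x y (cJ E p)) q = -m (T x y p) (cJ E q) := fun x y p q => by
      rw [hT.comm_J, hm.J_left]
    have hself : ∀ x y p, m (T x y p) p = 0 := fun x y p => by
      linarith [hT.metric_skew x y p p]
    have hcJ1 : ∀ x y, m (T x y v) (cJ E w) = 0 := by
      intro x y
      have h1 := hTh x y v (cJ E w)
      rw [hwdJ, hh.symm _ v, hva, hm.symm v, hT.metric_skew x y (cJ E w) v] at h1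
      have h2 : (d - a) * m (T x y v) (cJ E w) = 0 := by linear_combination h1
      exact (mul_eq_zero.1 h2).resolve_left (sub_ne_zero.2 (Ne.symm had))
    have hcJ2 : ∀ x y, m (T x y w) (cJ E v) = 0 := fun x y => by
      rw [hT.metric_skew, hJl, hcJ1]; simp
    -- Ricci curvatures in the directions `v` and `w`
    have hRv : m (T (cJ E v) v v) (cJ E v) = 0 := by
      have := hric b hbo v v
      rw [hb] at this
      simpa [Fin.sum_univ_four, hself, hcross, hcJ1] using this
    have hRw : m (T (cJ E w) w w) (cJ E w) = 0 := by
      have := hric b hbo w w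
      rw [hb] at this
      simpa [Fin.sum_univ_four, hself, hcross', hcJ2] using this
    -- the Bianchi identity kills the mixed component
    have hmixed : m (T v (cJ E v) w) (cJ E w) = 0 := by
      have h1 := congrArg (fun u => m u (cJ E w)) (hT.bianchi v (cJ E v) w)
      simp only [map_add, add_apply, map_zero,
        zero_apply] at h1
      rw [hcJ1, hJl, cJ_cJ, map_neg, hcross] at h1
      linarith
    have hmixed' : m (T w (cJ E w) v) (cJ E v) = 0 := by rw [hT.pair_symm, hmixed]
    have hline : ∀ p : E, ∀ x y, T x y p = 0 → T x y (cJ E p) = 0 := fun p x y h0 => by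
      rw [hT.comm_J, h0, map_zero]
    have hTv : ∀ x, T v (cJ E v) x = 0 := by
      have h1 : T v (cJ E v) v = 0 := hext _ (hself _ _ _)
        (by rw [hT.skew]; simp [hRv]) (hcross _ _) (hcJ1 _ _)
      have h2 : T v (cJ E v) w = 0 := hext _ (hcross' _ _) (hcJ2 _ _) (hself _ _ _) hmixed
      exact hlin _ (hT.linear _ _) h1 (hline _ _ _ h1) h2 (hline _ _ _ h2)
    have hTw : ∀ x, T w (cJ E w) x = 0 := by
      have h1 : T w (cJ E w) v = 0 := hext _ (hself _ _ _) hmixed' (hcross _ _) (hcJ1 _ _)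
      have h2 : T w (cJ E w) w = 0 := hext _ (hcross' _ _) (hcJ2 _ _) (hself _ _ _)
        (by rw [hT.skew]; simp [hRw])
      exact hlin _ (hT.linear _ _) h1 (hline _ _ _ h1) h2 (hline _ _ _ h2)
    intro x y
    have h1 : T x y v = 0 := hext _ (hself _ _ _)
      (by rw [hT.pair_symm, hTv]; simp) (hcross _ _) (hcJ1 _ _)
    have h2 : T x y w = 0 := hext _ (hcross' _ _) (hcJ2 _ _) (hself _ _ _)
      (by rw [hT.pair_symm, hTw]; simp)
    exact hlin _ (hT.linear _ _) h1 (hline _ _ _ h1) h2 (hline _ _ _ h2)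

end IsKahlerCurvature

end HermitianAlgebra

/-! ### The metric in a chart -/

section LocalMetric

open Bundle

variable {E : Type*} [NormedAddCommGroup E] [NormedSpace ℂ E]
  {M : Type*} [TopologicalSpace M] [ChartedSpace E M] [IsManifold 𝓘(ℂ, E) ω M]

theorem isManifold_one : IsManifold 𝓘(ℝ, E) 1 M :=
  IsManifold.of_le (n := ω) le_top

/-- The derivative of the inverse of the chart at `p`, between copies of `E`. -/
def chartDeriv (p : M) (y : E) : E →L[ℝ] E :=
  mfderiv 𝓘(ℝ, E) 𝓘(ℝ, E) (extChartAt 𝓘(ℝ, E) p).symm y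

theorem localMetric_apply (g : RiemMetric E M) (p : M) (y u v : E) :
    localMetric g p y u v = metricAt g ((extChartAt 𝓘(ℝ, E) p).symm y)
      (chartDeriv p y u) (chartDeriv p y v) := rfl

theorem chartDeriv_self (p : M) :
    chartDeriv p (extChartAt 𝓘(ℝ, E) p p) = ContinuousLinearMap.id ℝ E := by
  have := isManifold_one (E := E) (M := M)
  have h := mfderivWithin_range_extChartAt_symm (I := 𝓘(ℝ, E)) (x := p)
  rwa [ModelWithCorners.range_eq_univ, mfderivWithin_univ] at h

theorem chartDeriv_injective (p : M) {y : E} (hy : y ∈ (extChartAt 𝓘(ℝ, E) p).target) :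
    Function.Injective (chartDeriv p y) := by
  have := isManifold_one (E := E) (M := M)
  have h := isInvertible_mfderivWithin_extChartAt_symm (I := 𝓘(ℝ, E)) hy
  rw [ModelWithCorners.range_eq_univ, mfderivWithin_univ] at h
  exact h.injective

theorem localMetric_self (g : RiemMetric E M) (p : M) :
    localMetric g p (extChartAt 𝓘(ℝ, E) p p) = metricAt g p := by
  ext u v
  rw [localMetric_apply, chartDeriv_self, extChartAt_to_inv]
  rfl

/-- The derivative of the inverse chart is the inverse of the trivialization of the tangent
bundle. -/
theorem symmL_eq_chartDeriv (p : M) {y : E} (hy : y ∈ (extChartAt 𝓘(ℝ, E) p).target) :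
    (trivializationAt E (TangentSpace 𝓘(ℝ, E)) p).symmL ℝ ((extChartAt 𝓘(ℝ, E) p).symm y)
      = chartDeriv p y := by
  have := isManifold_one (E := E) (M := M)
  have hs : (extChartAt 𝓘(ℝ, E) p).symm y ∈ (chartAt E p).source := by
    rw [← extChartAt_source 𝓘(ℝ, E)]
    exact (extChartAt 𝓘(ℝ, E) p).map_target hy
  rw [TangentBundle.symmL_trivializationAt hs, ModelWithCorners.range_eq_univ, mfderivWithin_univ,
    (extChartAt 𝓘(ℝ, E) p).right_inv hy]
  rfl

/-- The metric in a chart is smooth: it is the metric, as a section of the bundle of bilinear forms,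
read in the trivialization over that chart. -/
theorem contDiffOn_localMetric [FiniteDimensional ℂ E] (g : RiemMetric E M) (p : M) :
    ContDiffOn ℝ ∞ (localMetric g p) (extChartAt 𝓘(ℝ, E) p).target := by
  have := isManifold_one (E := E) (M := M)
  have : IsManifold 𝓘(ℝ, E) (∞ + 1) M := IsManifold.of_le (n := ω) le_top
  have : IsManifold 𝓘(ℝ, E) ∞ M := IsManifold.of_le (n := ω) le_top
  have : FiniteDimensional ℝ E := FiniteDimensional.complexToReal E
  let e := trivializationAt (E →L[ℝ] E →L[ℝ] ℝ)
    (fun x : M => TangentSpace 𝓘(ℝ, E) x →L[ℝ] TangentSpace 𝓘(ℝ, E) x →L[ℝ] ℝ) p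
  have he : e.baseSet = (chartAt E p).source := by
    simp [e]
  have h1 := g.contMDiff.contMDiffOn (s := e.baseSet)
  have h2 := (e.contMDiffOn_section_baseSet_iff (IB := 𝓘(ℝ, E)) (n := ∞)).1 h1
  have h3 : ContMDiffOn 𝓘(ℝ, E) 𝓘(ℝ, E) ∞ (extChartAt 𝓘(ℝ, E) p).symm
      (extChartAt 𝓘(ℝ, E) p).target := contMDiffOn_extChartAt_symm p
  have hmaps : ∀ y ∈ (extChartAt 𝓘(ℝ, E) p).target,
      (extChartAt 𝓘(ℝ, E) p).symm y ∈ (chartAt E p).source := fun y hy => by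
    rw [← extChartAt_source 𝓘(ℝ, E)]
    exact (extChartAt 𝓘(ℝ, E) p).map_target hy
  have h4 := (h2.comp h3 (fun y hy => he ▸ hmaps y hy)).contDiffOn
  refine h4.congr fun y hy => ?_
  ext u v
  have hb : (extChartAt 𝓘(ℝ, E) p).symm y ∈
      (trivializationAt E (TangentSpace 𝓘(ℝ, E)) p).baseSet := by simpa using hmaps y hy
  rw [localMetric_apply, ← symmL_eq_chartDeriv p hy]
  simp only [Function.comp, e]
  rw [hom_trivializationAt_apply, inCoordinates_apply_eq₂ hb hb (Set.mem_univ _),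
    ← Trivialization.symmL_apply (R := ℝ) _ hb, ← Trivialization.symmL_apply (R := ℝ) _ hb]
  simp
  rfl

theorem isHermitianForm_metricAt {g : RiemMetric E M} (hg : IsKahler g) (p : M) :
    IsHermitianForm (metricAt g p) where
  symm := g.symm p
  pos := g.pos p
  inv := hg.hermitian p

/-- A complex differentiable map is real differentiable, and its real derivative is complex
linear. -/
theorem mfderiv_cJ {M F N : Type*} [TopologicalSpace M] [ChartedSpace E M] [NormedAddCommGroup F]
    [NormedSpace ℂ F] [TopologicalSpace N] [ChartedSpace F N] {f : M → N} {p : M}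
    (hf : MDifferentiableAt 𝓘(ℂ, E) 𝓘(ℂ, F) f p) :
    MDifferentiableAt 𝓘(ℝ, E) 𝓘(ℝ, F) f p ∧ ∀ v : E,
      (mfderiv 𝓘(ℝ, E) 𝓘(ℝ, F) f p : E →L[ℝ] F) (cJ E v) =
        cJ F ((mfderiv 𝓘(ℝ, E) 𝓘(ℝ, F) f p : E →L[ℝ] F) v) := by
  have h : HasMFDerivAt 𝓘(ℂ, E) 𝓘(ℂ, F) f p (mfderiv 𝓘(ℂ, E) 𝓘(ℂ, F) f p) := hf.hasMFDerivAt
  let A : E →L[ℂ] F := mfderiv 𝓘(ℂ, E) 𝓘(ℂ, F) f p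
  have h' : HasMFDerivAt 𝓘(ℝ, E) 𝓘(ℝ, F) f p (A.restrictScalars ℝ) :=
    ⟨h.1, HasFDerivWithinAt.restrictScalars ℝ h.2⟩
  refine ⟨h'.mdifferentiableAt, fun v => ?_⟩
  rw [h'.mfderiv]
  exact A.map_smul Complex.I v

theorem chartDeriv_cJ (p : M) {y : E} (hy : y ∈ (extChartAt 𝓘(ℝ, E) p).target) (v : E) :
    chartDeriv p y (cJ E v) = cJ E (chartDeriv p y v) := by
  have : IsManifold 𝓘(ℂ, E) 1 M := IsManifold.of_le (n := ω) le_top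
  have h : MDifferentiableAt 𝓘(ℂ, E) 𝓘(ℂ, E) (extChartAt 𝓘(ℂ, E) p).symm y :=
    (mdifferentiableOn_extChartAt_symm (I := 𝓘(ℂ, E)) y hy).mdifferentiableAt
      ((isOpen_extChartAt_target p).mem_nhds hy)
  exact (mfderiv_cJ h).2 v

theorem isHermitianForm_localMetric {g : RiemMetric E M} (hg : IsKahler g) (p : M) {y : E}
    (hy : y ∈ (extChartAt 𝓘(ℝ, E) p).target) : IsHermitianForm (localMetric g p y) where
  symm v w := by
    rw [localMetric_apply, localMetric_apply, (isHermitianForm_metricAt hg _).symm]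
  pos v hv := by
    rw [localMetric_apply]
    refine (isHermitianForm_metricAt hg _).pos _ fun h0 => hv ?_
    exact chartDeriv_injective p hy (by rw [h0, map_zero])
  inv v w := by
    rw [localMetric_apply, localMetric_apply, chartDeriv_cJ p hy, chartDeriv_cJ p hy,
      (isHermitianForm_metricAt hg _).inv]

end LocalMetric

/-! ### The Levi-Civita connection and its curvature -/

section LeviCivita

open Filter Topology

variable {E : Type*} [NormedAddCommGroup E] [NormedSpace ℂ E]

theorem fderiv_clm_apply₂ {V F : Type*} [NormedAddCommGroup V] [NormedSpace ℝ V]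
    [NormedAddCommGroup F] [NormedSpace ℝ F] {G : V → E →L[ℝ] E →L[ℝ] F} {y : V}
    (hG : DifferentiableAt ℝ G y) (v w : E) (u : V) :
    fderiv ℝ (fun y => G y v w) y u = fderiv ℝ G y u v w := by
  have h := (hG.hasFDerivAt.clm_apply (hasFDerivAt_const v y)).clm_apply (hasFDerivAt_const w y)
  rw [h.fderiv]
  simp

theorem eventually_mem_target {M : Type*} [TopologicalSpace M] [ChartedSpace E M] {p : M} {y : E}
    (hy : y ∈ (extChartAt 𝓘(ℝ, E) p).target) :
    ∀ᶠ z in 𝓝 y, z ∈ (extChartAt 𝓘(ℝ, E) p).target :=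
  (isOpen_extChartAt_target p).mem_nhds hy

variable [FiniteDimensional ℂ E]
  {M : Type*} [TopologicalSpace M] [ChartedSpace E M] [IsManifold 𝓘(ℂ, E) ω M]
  {g : RiemMetric E M} {p : M} {y : E}

theorem contDiffAt_localMetric (hy : y ∈ (extChartAt 𝓘(ℝ, E) p).target) :
    ContDiffAt ℝ ∞ (localMetric g p) y :=
  (contDiffOn_localMetric g p).contDiffAt ((isOpen_extChartAt_target p).mem_nhds hy)

theorem differentiableAt_localMetric (hy : y ∈ (extChartAt 𝓘(ℝ, E) p).target) :
    DifferentiableAt ℝ (localMetric g p) y :=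
  (contDiffAt_localMetric hy).differentiableAt (by simp)

theorem contDiffAt_fderiv_localMetric (hy : y ∈ (extChartAt 𝓘(ℝ, E) p).target) :
    ContDiffAt ℝ ∞ (fderiv ℝ (localMetric g p)) y :=
  (contDiffAt_localMetric hy).fderiv_right (by simp)

theorem fderiv_localMetric_symm (hg : IsKahler g) (hy : y ∈ (extChartAt 𝓘(ℝ, E) p).target)
    (u v w : E) : fderiv ℝ (localMetric g p) y u v w = fderiv ℝ (localMetric g p) y u w v := by
  have hd := differentiableAt_localMetric (g := g) hy
  rw [← fderiv_clm_apply₂ hd, ← fderiv_clm_apply₂ hd]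
  congr 1
  refine EventuallyEq.fderiv_eq ?_
  filter_upwards [eventually_mem_target hy] with z hz
  exact (isHermitianForm_localMetric hg p hz).symm v w

theorem fderiv_localMetric_J (hg : IsKahler g) (hy : y ∈ (extChartAt 𝓘(ℝ, E) p).target)
    (u v w : E) : fderiv ℝ (localMetric g p) y u (cJ E v) w
      = -fderiv ℝ (localMetric g p) y u v (cJ E w) := by
  have h : fderiv ℝ (localMetric g p) y u (cJ E v) (cJ E (cJ E w))
      = fderiv ℝ (localMetric g p) y u v (cJ E w) := by
    have hd := differentiableAt_localMetric (g := g) hy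
    rw [← fderiv_clm_apply₂ hd, ← fderiv_clm_apply₂ hd]
    congr 1
    refine EventuallyEq.fderiv_eq ?_
    filter_upwards [eventually_mem_target hy] with z hz
    exact (isHermitianForm_localMetric hg p hz).inv v _
  rw [cJ_cJ, map_neg] at h
  linarith

/-- The defining equation of the Christoffel symbols. -/
theorem localMetric_christoffel (hg : IsKahler g) (hy : y ∈ (extChartAt 𝓘(ℝ, E) p).target)
    (u v w : E) : 2 * localMetric g p y (christoffel g p y u v) w =
      fderiv ℝ (localMetric g p) y u v w + fderiv ℝ (localMetric g p) y v u w
        - fderiv ℝ (localMetric g p) y w u v := by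
  rw [christoffel_apply, map_smul, (isHermitianForm_localMetric hg p hy).apply_inverse]
  simp

theorem christoffel_symm (hg : IsKahler g) (hy : y ∈ (extChartAt 𝓘(ℝ, E) p).target)
    (u v : E) : christoffel g p y u v = christoffel g p y v u := by
  refine (isHermitianForm_localMetric hg p hy).eq_of_forall fun w => ?_
  linarith [localMetric_christoffel hg hy u v w, localMetric_christoffel hg hy v u w,
    fderiv_localMetric_symm hg hy w u v]

/-- The Levi-Civita connection is metric. -/
theorem fderiv_localMetric_eq (hg : IsKahler g) (hy : y ∈ (extChartAt 𝓘(ℝ, E) p).target)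
    (u v w : E) : fderiv ℝ (localMetric g p) y u v w =
      localMetric g p y (christoffel g p y u v) w
        + localMetric g p y v (christoffel g p y u w) := by
  rw [(isHermitianForm_localMetric hg p hy).symm v]
  linarith [localMetric_christoffel hg hy u v w, localMetric_christoffel hg hy u w v,
    fderiv_localMetric_symm hg hy u v w, fderiv_localMetric_symm hg hy v u w,
    fderiv_localMetric_symm hg hy w u v]

/-- The complex structure of a Kähler metric is parallel. In a holomorphic chart `J` is constant,
and the identity is the difference of the closedness relations for `(u, v, w)` and `(u, Jv, Jw)`. -/
theorem christoffel_J (hg : IsKahler g) (hy : y ∈ (extChartAt 𝓘(ℝ, E) p).target)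
    (u v : E) : christoffel g p y u (cJ E v) = cJ E (christoffel g p y u v) := by
  have hm := isHermitianForm_localMetric hg p hy
  refine hm.eq_of_forall fun w => ?_
  rw [hm.J_left]
  have c1 := hg.closed p y hy u v w
  have c2 := hg.closed p y hy u (cJ E v) (cJ E w)
  rw [cJ_cJ, cJ_cJ] at c2
  simp only [map_neg, neg_apply] at c2
  have J := fderiv_localMetric_J hg hy
  have S := fderiv_localMetric_symm hg hy
  linarith [localMetric_christoffel hg hy u (cJ E v) w, localMetric_christoffel hg hy u v (cJ E w),
    J u v w, J v w u, J w u v, J (cJ E w) u v, J (cJ E v) w u, S u v w, S v w u, S w u v,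
    S v (cJ E w) u, S w (cJ E v) u, S (cJ E v) w u, S (cJ E w) u v,
    (by have := J (cJ E w) u (cJ E v); rwa [cJ_cJ, map_neg, neg_neg] at this :
      fderiv ℝ (localMetric g p) y (cJ E w) (cJ E u) (cJ E v)
        = fderiv ℝ (localMetric g p) y (cJ E w) u v)]

theorem differentiableAt_christoffel (hg : IsKahler g)
    (hy : y ∈ (extChartAt 𝓘(ℝ, E) p).target) : DifferentiableAt ℝ (christoffel g p) y := by
  have : FiniteDimensional ℝ E := FiniteDimensional.complexToReal E
  have hD : ContDiffOn ℝ ∞ (fderiv ℝ (localMetric g p)) (extChartAt 𝓘(ℝ, E) p).target :=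
    fun z hz => (contDiffAt_fderiv_localMetric hz).contDiffWithinAt
  have hinv : ContDiffOn ℝ ∞ (fun z => (localMetric g p z).inverse)
      (extChartAt 𝓘(ℝ, E) p).target := fun z hz =>
    ((isHermitianForm_localMetric hg p hz).isInvertible.contDiffAt_map_inverse.comp z
      (contDiffAt_localMetric hz)).contDiffWithinAt
  have hD' := fun u v w : E => ((hD.clm_apply (contDiffOn_const (c := u))).clm_apply
    (contDiffOn_const (c := v))).clm_apply (contDiffOn_const (c := w))
  have h : ContDiffOn ℝ ∞ (christoffel g p) (extChartAt 𝓘(ℝ, E) p).target := by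
    refine contDiffOn_clm_apply.2 fun u => contDiffOn_clm_apply.2 fun v => ?_
    simp only [christoffel_apply]
    refine contDiffOn_const.smul (hinv.clm_apply (contDiffOn_clm_apply.2 fun w => ?_))
    exact ((hD' u v w).add (hD' v u w)).sub (hD' w u v)
  exact (h.contDiffAt (eventually_mem_target hy)).differentiableAt (by simp)

theorem fderiv_christoffel_symm (hg : IsKahler g) (hy : y ∈ (extChartAt 𝓘(ℝ, E) p).target)
    (x u v : E) : fderiv ℝ (christoffel g p) y x u v = fderiv ℝ (christoffel g p) y x v u := by
  have hd := differentiableAt_christoffel hg hy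
  rw [← fderiv_clm_apply₂ hd, ← fderiv_clm_apply₂ hd]
  congr 1
  refine EventuallyEq.fderiv_eq ?_
  filter_upwards [eventually_mem_target hy] with z hz
  exact christoffel_symm hg hz u v

theorem fderiv_christoffel_J (hg : IsKahler g) (hy : y ∈ (extChartAt 𝓘(ℝ, E) p).target)
    (x u v : E) : fderiv ℝ (christoffel g p) y x u (cJ E v)
      = cJ E (fderiv ℝ (christoffel g p) y x u v) := by
  have hd := differentiableAt_christoffel hg hy
  have h1 : HasFDerivAt (fun z => cJ E (christoffel g p z u v)) _ y :=
    (cJ E).hasFDerivAt.comp y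
      ((hd.hasFDerivAt.clm_apply (hasFDerivAt_const u y)).clm_apply (hasFDerivAt_const v y))
  have h2 : fderiv ℝ (fun z => christoffel g p z u (cJ E v)) y
      = fderiv ℝ (fun z => cJ E (christoffel g p z u v)) y := by
    refine EventuallyEq.fderiv_eq ?_
    filter_upwards [eventually_mem_target hy] with z hz
    exact christoffel_J hg hz u v
  rw [← fderiv_clm_apply₂ hd, h2, h1.fderiv]
  simp

/-- The derivative of the metricity relation. The left side is symmetric in `x` and `u`, which makes
the curvature skew for the metric. -/
theorem fderiv_fderiv_localMetric (hg : IsKahler g) (hy : y ∈ (extChartAt 𝓘(ℝ, E) p).target)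
    (x u v w : E) : fderiv ℝ (fderiv ℝ (localMetric g p)) y x u v w =
      fderiv ℝ (localMetric g p) y x (christoffel g p y u v) w
        + localMetric g p y (fderiv ℝ (christoffel g p) y x u v) w
        + (fderiv ℝ (localMetric g p) y x v (christoffel g p y u w)
        + localMetric g p y v (fderiv ℝ (christoffel g p) y x u w)) := by
  have hG := (differentiableAt_localMetric (g := g) hy).hasFDerivAt
  have hΓ := (differentiableAt_christoffel hg hy).hasFDerivAt
  have hD := ((contDiffAt_fderiv_localMetric (g := g) hy).differentiableAt (by simp)).hasFDerivAt
  have c := fun v : E => hasFDerivAt_const (𝕜 := ℝ) v y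
  have h1 := ((hD.clm_apply (c u)).clm_apply (c v)).clm_apply (c w)
  have h2 := ((hG.clm_apply ((hΓ.clm_apply (c u)).clm_apply (c v))).clm_apply (c w)).add
    ((hG.clm_apply (c v)).clm_apply ((hΓ.clm_apply (c u)).clm_apply (c w)))
  have h3 := h1.congr_of_eventuallyEq (f₁ := _) (EventuallyEq.symm (by
    filter_upwards [eventually_mem_target hy] with z hz
    exact fderiv_localMetric_eq hg hz u v w))
  have := congrArg (fun L => L x) (h3.unique h2)
  simp at this
  linarith

theorem isKahlerCurvature_curvature (hg : IsKahler g) (p : M) :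
    IsKahlerCurvature (metricAt g p) (fun x y z => curvature g p x y z) where
  linear x y := (curvature g p x y).toLinearMap.isLinear
  skew x y z := by
    simp only [curvature_apply]
    abel
  bianchi x y z := by
    have hy := mem_extChartAt_target (I := 𝓘(ℝ, E)) p
    have A := fderiv_christoffel_symm hg hy
    have Γ := christoffel_symm hg hy
    simp only [curvature_apply]
    rw [A x y z, A y z x, A z x y, Γ x y, Γ y z, Γ z x]
    abel
  metric_skew x y z w := by
    have hy := mem_extChartAt_target (I := 𝓘(ℝ, E)) p
    rw [← localMetric_self]
    have hm := isHermitianForm_localMetric hg p hy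
    have h1 := fderiv_fderiv_localMetric hg hy x y z w
    have h2 := fderiv_fderiv_localMetric hg hy y x z w
    have h3 : fderiv ℝ (fderiv ℝ (localMetric g p)) (extChartAt 𝓘(ℝ, E) p p) x y
        = fderiv ℝ (fderiv ℝ (localMetric g p)) (extChartAt 𝓘(ℝ, E) p p) y x :=
      (contDiffAt_localMetric hy).isSymmSndFDerivAt
        (by
          rw [minSmoothness_of_isRCLikeNormedField]
          exact WithTop.coe_le_coe.2 (le_top (a := (2 : ℕ∞)))) x y
    rw [h3, h2] at h1
    simp only [fderiv_localMetric_eq hg hy] at h1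
    simp only [curvature_apply, map_add, map_sub, add_apply, sub_apply]
    rw [hm.symm _ z, hm.symm _ z, hm.symm _ z, hm.symm _ z]
    linarith
  comm_J x y z := by
    have hy := mem_extChartAt_target (I := 𝓘(ℝ, E)) p
    simp only [curvature_apply, fderiv_christoffel_J hg hy, christoffel_J hg hy, map_add, map_sub]

end LeviCivita

/-! ### The Ricci and Bochner tensors -/

section Bochner

variable {E : Type*} [NormedAddCommGroup E] [NormedSpace ℂ E]

theorem sum_repr_orthonormal {m : E →L[ℝ] E →L[ℝ] ℝ} {ι : Type*}
    [Fintype ι] [DecidableEq ι] (b : Module.Basis ι ℝ E)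
    (hb : ∀ i j, m (b i) (b j) = if i = j then 1 else 0) (φ : E →L[ℝ] ℝ) (y : E) :
    ∑ i, φ (b i) * m y (b i) = φ y := by
  have hy : ∀ i, m y (b i) = b.repr y i := fun i => by
    conv_lhs => rw [← b.sum_repr y]
    simp only [map_sum, map_smul, sum_apply, smul_apply, hb, smul_eq_mul, mul_ite, mul_one,
      mul_zero, Finset.sum_ite_eq', Finset.mem_univ, if_true]
  conv_rhs => rw [← b.sum_repr y]
  simp only [map_sum, map_smul, smul_eq_mul, hy]
  exact Finset.sum_congr rfl fun i _ => mul_comm _ _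

theorem finrank_complex_eq_two (hdim : Module.finrank ℝ E = 4) : Module.finrank ℂ E = 2 := by
  have := finrank_real_of_complex E
  omega

variable [FiniteDimensional ℂ E]
  {M : Type*} [TopologicalSpace M] [ChartedSpace E M] [IsManifold 𝓘(ℂ, E) ω M]
  {g : RiemMetric E M}

theorem metricAt_ricciOp (hg : IsKahler g) (p : M) (x w : E) :
    metricAt g p (ricciOp g p x) w = ricci g p x w := by
  rw [ricciOp, ContinuousLinearMap.comp_apply, (isHermitianForm_metricAt hg p).apply_inverse]

theorem ricci_eq_sum {ι : Type*} [Fintype ι] [DecidableEq ι] {p : M}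
    (b : Module.Basis ι ℝ E) (hb : ∀ i j, metricAt g p (b i) (b j) = if i = j then 1 else 0)
    (y z : E) : ricci g p y z = ∑ i, metricAt g p (curvature g p (b i) y z) (b i) := by
  rw [ricci_apply, trace_eq_sum b hb]
  rfl

theorem scalarCurv_eq_sum (hg : IsKahler g) {ι : Type*} [Fintype ι] [DecidableEq ι] {p : M}
    (b : Module.Basis ι ℝ E) (hb : ∀ i j, metricAt g p (b i) (b j) = if i = j then 1 else 0) :
    scalarCurv g p = ∑ i, ricci g p (b i) (b i) := by
  rw [scalarCurv, trace_eq_sum b hb]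
  exact Finset.sum_congr rfl fun i _ => metricAt_ricciOp hg p _ _

/-- The `g`-adjoint of `x ↦ R(x, y) z` is `x ↦ R(x, z) y`, so the Ricci tensor is symmetric. -/
theorem ricci_symm (hg : IsKahler g) (hdim : Module.finrank ℝ E = 4) (p : M) (y z : E) :
    ricci g p y z = ricci g p z y := by
  obtain ⟨b, hb⟩ := (isHermitianForm_metricAt hg p).exists_orthonormal_basis hdim
  rw [ricci_eq_sum b hb, ricci_eq_sum b hb]
  refine Finset.sum_congr rfl fun i _ => ?_
  have hR := isKahlerCurvature_curvature hg p
  rw [hR.pair_symm (b i) y z, hR.skew z, map_neg, neg_apply, hR.metric_skew, neg_neg]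

/-- The Ricci tensor is invariant under `J`, since `R(x, Jy) Jz = -J R(Jx, y) z` and the traces of
`A` and `-JAJ` agree. -/
theorem ricci_inv (hg : IsKahler g) (p : M) (y z : E) :
    ricci g p (cJ E y) (cJ E z) = ricci g p y z := by
  have hR := isKahlerCurvature_curvature hg p
  have hm := isHermitianForm_metricAt hg p
  let A : Module.End ℝ E := (((curvature g p).flip y).flip z).toLinearMap
  let J : Module.End ℝ E := (cJ E).toLinearMap
  have hA : (((curvature g p).flip (cJ E y)).flip (cJ E z)).toLinearMap = -(J * (A * J)) := by
    ext x
    change curvature g p x (cJ E y) (cJ E z) = -cJ E (curvature g p (cJ E x) y z)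
    have h1 := hR.comm_J x (cJ E y) z
    have h2 := hR.apply_J_J hm x (cJ E y) z
    simp only [cJ_cJ, map_neg, neg_apply] at h1 h2
    rw [h1, ← h2, map_neg]
  have hJ : J * J = -1 := by
    ext x
    exact cJ_cJ x
  rw [ricci_apply, hA, map_neg, LinearMap.trace_mul_comm, mul_assoc, hJ, mul_neg, mul_one, map_neg,
    neg_neg]
  rfl

/-- The Bochner tensor at `p`, on copies of `E`. -/
def bochnerAt (g : RiemMetric E M) (p : M) (x y z : E) : E := bochner g p x y z

/-- The Bochner tensor of a Kähler surface, with all indices lowered. -/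
theorem metricAt_bochner (hg : IsKahler g) (hdim : Module.finrank ℝ E = 4) (p : M)
    (x y z w : E) : metricAt g p (bochnerAt g p x y z) w =
      metricAt g p (curvature g p x y z) w
      - (1 / 8) * (ricci g p y z * metricAt g p x w - ricci g p x z * metricAt g p y w
        + metricAt g p y z * ricci g p x w - metricAt g p x z * ricci g p y w
        + ricci g p (cJ E y) z * metricAt g p (cJ E x) w
        - ricci g p (cJ E x) z * metricAt g p (cJ E y) w
        + metricAt g p (cJ E y) z * ricci g p (cJ E x) w
        - metricAt g p (cJ E x) z * ricci g p (cJ E y) w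
        - 2 * ricci g p (cJ E x) y * metricAt g p (cJ E z) w
        - 2 * metricAt g p (cJ E x) y * ricci g p (cJ E z) w)
      + scalarCurv g p / 48 * (metricAt g p y z * metricAt g p x w
        - metricAt g p x z * metricAt g p y w
        + metricAt g p (cJ E y) z * metricAt g p (cJ E x) w
        - metricAt g p (cJ E x) z * metricAt g p (cJ E y) w
        - 2 * metricAt g p (cJ E x) y * metricAt g p (cJ E z) w) := by
  simp only [bochnerAt, bochner, finrank_complex_eq_two hdim]
  have h1 : (1 / (2 * (((2 : ℕ) : ℝ) + 2))) = 1 / 8 := by norm_num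
  have h2 : scalarCurv g p / (4 * (((2 : ℕ) : ℝ) + 1) * (((2 : ℕ) : ℝ) + 2))
      = scalarCurv g p / 48 := by norm_num
  rw [h1, h2]
  simp only [map_add, map_sub, map_smul, add_apply, sub_apply, smul_apply, smul_eq_mul,
    metricAt_ricciOp hg]

/-- The Bochner tensor has the algebraic symmetries of a Kähler curvature tensor. -/
theorem isKahlerCurvature_bochner (hg : IsKahler g) (hdim : Module.finrank ℝ E = 4) (p : M) :
    IsKahlerCurvature (metricAt g p) (bochnerAt g p) := by
  have hR := isKahlerCurvature_curvature hg p
  have hm := isHermitianForm_metricAt hg p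
  have B := metricAt_bochner hg hdim p
  have ms := hm.symm
  have mJ := hm.J_left
  have ss := ricci_symm hg hdim p
  have sJ : ∀ x y, ricci g p (cJ E x) y = -ricci g p x (cJ E y) := fun x y => by
    have := ricci_inv hg p x (cJ E y)
    rw [cJ_cJ, map_neg] at this
    linarith
  have mJ' : ∀ x y, metricAt g p x (cJ E y) = -metricAt g p y (cJ E x) := fun x y => by
    rw [ms, mJ]
  have sJ' : ∀ x y, ricci g p x (cJ E y) = -ricci g p y (cJ E x) := fun x y => by
    rw [ss, sJ]
  refine ⟨fun x y => ⟨fun z z' => ?_, fun c z => ?_⟩, fun x y z => ?_, fun x y z => ?_,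
    fun x y z w => ?_, fun x y z => ?_⟩
  · refine hm.eq_of_forall fun w => ?_
    rw [map_add, add_apply, B, B, B]
    simp only [map_add, add_apply]
    ring
  · refine hm.eq_of_forall fun w => ?_
    change metricAt g p (bochnerAt g p x y (c • z)) w
      = metricAt g p (c • (bochnerAt g p x y z)) w
    rw [map_smul, smul_apply, B, B]
    simp only [map_smul, smul_apply, smul_eq_mul]
    ring
  · refine hm.eq_of_forall fun w => ?_
    rw [map_neg, neg_apply, B, B, hR.skew x y z, map_neg, neg_apply]
    simp only [mJ, sJ, mJ' y x, sJ' y x]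
    ring
  · refine hm.eq_of_forall fun w => ?_
    have h := congrArg (fun u => metricAt g p u w) (hR.bianchi x y z)
    simp only [map_add, add_apply, map_zero, zero_apply] at h
    simp only [map_add, add_apply, map_zero, zero_apply]
    rw [B, B, B]
    simp only [mJ, sJ, mJ' y x, sJ' y x, mJ' z x, sJ' z x, mJ' z y, sJ' z y, ms y x, ms z x, ms z y,
      ss y x, ss z x, ss z y]
    linear_combination h
  · rw [B, B]
    simp only [mJ, sJ, mJ' w z, sJ' w z]
    linear_combination hR.metric_skew x y z w
  · refine hm.eq_of_forall fun w => ?_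
    rw [mJ, B, B]
    have h : metricAt g p (curvature g p x y (cJ E z)) w
        = -metricAt g p (curvature g p x y z) (cJ E w) := by
      rw [← mJ]
      exact congrArg (fun u => metricAt g p u w) (hR.comm_J x y z)
    simp only [mJ, sJ, cJ_cJ, map_neg, neg_apply]
    linear_combination h

/-- The Bochner tensor is Ricci-flat; this is what its numerical coefficients are chosen for. -/
theorem sum_metricAt_bochner (hg : IsKahler g) (hdim : Module.finrank ℝ E = 4) (p : M)
    (b : Module.Basis (Fin 4) ℝ E)
    (hb : ∀ i j, metricAt g p (b i) (b j) = if i = j then 1 else 0) (y z : E) :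
    ∑ i, metricAt g p (bochnerAt g p (b i) y z) (b i) = 0 := by
  have hm := isHermitianForm_metricAt hg p
  have ms := hm.symm
  have mJ := hm.J_left
  have ss := ricci_symm hg hdim p
  have sJ : ∀ x y, ricci g p (cJ E x) y = -ricci g p x (cJ E y) := fun x y => by
    have := ricci_inv hg p x (cJ E y)
    rw [cJ_cJ, map_neg] at this
    linarith
  have sJself : ∀ x, ricci g p x (cJ E x) = 0 := fun x => by
    have h1 := ss x (cJ E x)
    rw [sJ] at h1
    linarith
  have C := sum_repr_orthonormal b hb
  have hone : ∀ i, metricAt g p (b i) (b i) = 1 := fun i => by simp [hb]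
  -- the contractions of the individual terms
  have t1 := C (ricci g p z) y
  have t2 := C (ricci g p y) z
  have t3 := C (ricci g p (cJ E z)) (cJ E y)
  have t4 := C (ricci g p (cJ E y)) (cJ E z)
  have t5 := C (metricAt g p z) y
  have t6 := C (metricAt g p (cJ E z)) (cJ E y)
  have hS := scalarCurv_eq_sum hg b hb
  have hR := ricci_eq_sum b hb y z
  have key : ∀ i, metricAt g p (bochnerAt g p (b i) y z) (b i) =
      metricAt g p (curvature g p (b i) y z) (b i)
      - (1 / 8) * (ricci g p y z - ricci g p z (b i) * metricAt g p y (b i)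
        + metricAt g p y z * ricci g p (b i) (b i) - ricci g p y (b i) * metricAt g p z (b i)
        + 3 * (ricci g p (cJ E z) (b i) * metricAt g p (cJ E y) (b i))
        + 3 * (ricci g p (cJ E y) (b i) * metricAt g p (cJ E z) (b i)))
      + scalarCurv g p / 48 * (metricAt g p y z - metricAt g p z (b i) * metricAt g p y (b i)
        + 3 * (metricAt g p (cJ E z) (b i) * metricAt g p (cJ E y) (b i))) := by
    intro i
    rw [metricAt_bochner hg hdim]
    simp only [mJ, sJ, hm.self_J, sJself, hone, ms (b i) z, ss (b i) z,
      ms (b i) (cJ E y), ms (b i) (cJ E z), ss (b i) (cJ E y), ss (b i) (cJ E z)]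
    ring
  simp only [key, Finset.sum_add_distrib, Finset.sum_sub_distrib, ← Finset.mul_sum, t1, t2, t3, t4,
    t5, t6, ← hS, ← hR, Finset.sum_const, Finset.card_univ, Fintype.card_fin, nsmul_eq_mul,
    ricci_inv hg, hm.inv, ss z y, ms z y]
  ring

end Bochner

/-! ### Conformal holomorphic maps -/

section Conformal

open Filter Topology

variable {E : Type*} [NormedAddCommGroup E] [NormedSpace ℂ E]

/-- Nondegeneracy of the Kähler form, as multiplication by it on covectors: if `ℓ ∧ ω = 0` in
complex dimension two, then `ℓ = 0`. -/
theorem IsHermitianForm.eq_zero_of_wedge_eq_zero [FiniteDimensional ℂ E] {m : E →L[ℝ] E →L[ℝ] ℝ}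
    (hm : IsHermitianForm m) (hdim : Module.finrank ℝ E = 4) {l : E →L[ℝ] ℝ}
    (hl : ∀ u v w, l u * m (cJ E v) w + l v * m (cJ E w) u + l w * m (cJ E u) v = 0) : l = 0 := by
  ext u
  obtain ⟨v, hv, huv, hJuv⟩ := hm.exists_unit_orthogonal hdim u
  have h := hl u v (cJ E v)
  rw [cJ_cJ, hm.inv, hv, hJuv, map_neg, neg_apply, hm.symm v u, huv] at h
  simpa using h

variable {M : Type*} [TopologicalSpace M] [ChartedSpace E M]

/-- The map `f` in the charts at `p` and `f p`, taken as complex charts; as maps these are the real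
ones. -/
def localMap (f : M → M) (p : M) : E → E :=
  extChartAt 𝓘(ℂ, E) (f p) ∘ f ∘ (extChartAt 𝓘(ℂ, E) p).symm

/-- The part of the chart at `p` which `f` maps into the chart at `f p`. -/
def localDomain (f : M → M) (p : M) : Set E :=
  (extChartAt 𝓘(ℂ, E) p).target ∩
    (extChartAt 𝓘(ℂ, E) p).symm ⁻¹' (f ⁻¹' (extChartAt 𝓘(ℂ, E) (f p)).source)

theorem isOpen_localDomain {f : M → M} (hf : Continuous f) (p : M) :
    IsOpen (localDomain (E := E) f p) :=
  (continuousOn_extChartAt_symm p).isOpen_inter_preimage (isOpen_extChartAt_target p)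
    ((isOpen_extChartAt_source (f p)).preimage hf)

theorem mem_localDomain (f : M → M) (p : M) : extChartAt 𝓘(ℂ, E) p p ∈ localDomain f p := by
  refine ⟨mem_extChartAt_target p, ?_⟩
  rw [Set.mem_preimage, extChartAt_to_inv]
  exact mem_extChartAt_source (f p)

variable [IsManifold 𝓘(ℂ, E) ω M] {f : M → M} {p : M} {y : E}

theorem contDiffOn_localMap (hf : ContMDiff 𝓘(ℂ, E) 𝓘(ℂ, E) ω f) (p : M) :
    ContDiffOn ℂ ω (localMap f p) (localDomain (E := E) f p) := by
  have h1 : ContMDiffOn 𝓘(ℂ, E) 𝓘(ℂ, E) ω (extChartAt 𝓘(ℂ, E) p).symm (localDomain (E := E) f p) :=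
    (contMDiffOn_extChartAt_symm p).mono Set.inter_subset_left
  have h2 : ContMDiffOn 𝓘(ℂ, E) 𝓘(ℂ, E) ω (extChartAt 𝓘(ℂ, E) (f p))
      (extChartAt 𝓘(ℂ, E) (f p)).source := by
    rw [extChartAt_source]
    exact contMDiffOn_extChartAt
  exact (h2.comp (hf.comp_contMDiffOn h1) fun y hy => hy.2).contDiffOn

theorem contDiffAt_localMap (hf : ContMDiff 𝓘(ℂ, E) 𝓘(ℂ, E) ω f) (hy : y ∈ localDomain f p) :
    ContDiffAt ℝ ∞ (localMap f p) y :=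
  (((contDiffOn_localMap hf p).contDiffAt
    ((isOpen_localDomain hf.continuous p).mem_nhds hy)).restrict_scalars ℝ).of_le le_top

theorem fderiv_localMap_J (hf : ContMDiff 𝓘(ℂ, E) 𝓘(ℂ, E) ω f) (hy : y ∈ localDomain f p)
    (v : E) : fderiv ℝ (localMap f p) y (cJ E v) = cJ E (fderiv ℝ (localMap f p) y v) := by
  have h : DifferentiableAt ℂ (localMap f p) y :=
    ((contDiffOn_localMap hf p).contDiffAt
      ((isOpen_localDomain hf.continuous p).mem_nhds hy)).differentiableAt (by simp)
  rw [h.fderiv_restrictScalars ℝ]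
  exact (fderiv ℂ (localMap f p) y).map_smul Complex.I v

theorem fderiv_fderiv_localMap_J (hf : ContMDiff 𝓘(ℂ, E) 𝓘(ℂ, E) ω f)
    (hy : y ∈ localDomain f p) (u v : E) :
    fderiv ℝ (fderiv ℝ (localMap f p)) y u (cJ E v)
      = cJ E (fderiv ℝ (fderiv ℝ (localMap f p)) y u v) := by
  have hd : HasFDerivAt (fderiv ℝ (localMap f p)) _ y :=
    (((contDiffAt_localMap hf hy).fderiv_right (m := ∞) (by simp)).differentiableAt
      (by simp)).hasFDerivAt
  have h1 := hd.clm_apply (hasFDerivAt_const (cJ E v) y)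
  have h2 : HasFDerivAt (fun z => cJ E (fderiv ℝ (localMap f p) z v)) _ y :=
    (cJ E).hasFDerivAt.comp y (hd.clm_apply (hasFDerivAt_const v y))
  have h3 := h1.congr_of_eventuallyEq (f₁ := fun z => cJ E (fderiv ℝ (localMap f p) z v)) (by
    filter_upwards [(isOpen_localDomain hf.continuous p).mem_nhds hy] with z hz
    exact (fderiv_localMap_J hf hz v).symm)
  simpa using congrArg (fun L => L u) (h3.unique h2)

/-- The derivative of `f` in the charts at `p` and `f p`. -/
theorem mfderiv_chartDeriv (hf : ContMDiff 𝓘(ℂ, E) 𝓘(ℂ, E) ω f) (hy : y ∈ localDomain f p)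
    (u : E) : (mfderiv 𝓘(ℝ, E) 𝓘(ℝ, E) f ((extChartAt 𝓘(ℝ, E) p).symm y) : E →L[ℝ] E)
        (chartDeriv p y u)
      = chartDeriv (f p) (localMap f p y) (fderiv ℝ (localMap f p) y u) := by
  have := isManifold_one (E := E) (M := M)
  have hy' : localMap f p y ∈ (extChartAt 𝓘(ℝ, E) (f p)).target :=
    (extChartAt 𝓘(ℂ, E) (f p)).map_source hy.2
  have hf' : MDifferentiableAt 𝓘(ℝ, E) 𝓘(ℝ, E) f ((extChartAt 𝓘(ℝ, E) p).symm y) :=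
    (mfderiv_cJ (hf.mdifferentiableAt (by simp))).1
  have hs : ∀ (q : M) (z : E), z ∈ (extChartAt 𝓘(ℝ, E) q).target →
      MDifferentiableAt 𝓘(ℝ, E) 𝓘(ℝ, E) (extChartAt 𝓘(ℝ, E) q).symm z := fun q z hz =>
    (mdifferentiableOn_extChartAt_symm z hz).mdifferentiableAt
      ((isOpen_extChartAt_target q).mem_nhds hz)
  have hF : MDifferentiableAt 𝓘(ℝ, E) 𝓘(ℝ, E) (localMap f p) y :=
    ((contDiffAt_localMap hf hy).differentiableAt (by simp)).mdifferentiableAt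
  have h1 := mfderiv_comp y hf' (hs p y hy.1)
  have h2 := mfderiv_comp y (hs (f p) _ hy') hF
  have h3 : (extChartAt 𝓘(ℝ, E) (f p)).symm ∘ localMap f p
      =ᶠ[𝓝 y] f ∘ (extChartAt 𝓘(ℝ, E) p).symm := by
    filter_upwards [(isOpen_localDomain hf.continuous p).mem_nhds hy] with z hz
    exact (extChartAt 𝓘(ℂ, E) (f p)).left_inv hz.2
  have h4 := h3.mfderiv_eq (I := 𝓘(ℝ, E)) (I' := 𝓘(ℝ, E))
  have h5 := (h1.symm.trans (h4.symm.trans h2))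
  rw [mfderiv_eq_fderiv] at h5
  exact DFunLike.congr_fun h5 u

variable [FiniteDimensional ℂ E] {g : RiemMetric E M}

/-- A holomorphic map which is conformal on tangent spaces, with factor `c`, pulls back the Kähler
form `ω` to `c ω`. Both forms are closed, so `dc ∧ ω = 0` and `dc = 0`. -/
theorem eventually_conformal_factor_eq (hg : IsKahler g) (hdim : Module.finrank ℝ E = 4)
    (hf : ContMDiff 𝓘(ℂ, E) 𝓘(ℂ, E) ω f) (c : M → ℝ)
    (hc : ∀ (p : M) (v w : E), metricAt g (f p) (mfderiv 𝓘(ℝ, E) 𝓘(ℝ, E) f p v)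
      (mfderiv 𝓘(ℝ, E) 𝓘(ℝ, E) f p w) = c p * metricAt g p v w) (p : M) :
    ∀ᶠ q in 𝓝 p, c q = c p := by
  have : FiniteDimensional ℝ E := FiniteDimensional.complexToReal E
  have : Nontrivial E := Module.nontrivial_of_finrank_pos (R := ℝ) (by omega)
  obtain ⟨e, he⟩ := exists_ne (0 : E)
  set V := localDomain (E := E) f p with hV
  have hVo : IsOpen V := isOpen_localDomain hf.continuous p
  set F := localMap (E := E) f p with hF
  set L : E → ℝ := fun y => c ((extChartAt 𝓘(ℝ, E) p).symm y) with hL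
  have hFm : ∀ y ∈ V, F y ∈ (extChartAt 𝓘(ℝ, E) (f p)).target := fun y hy =>
    (extChartAt 𝓘(ℂ, E) (f p)).map_source hy.2
  -- the conformality relation in the charts
  have hconf : ∀ y ∈ V, ∀ v w, L y * localMetric g p y v w =
      localMetric g (f p) (F y) (fderiv ℝ F y v) (fderiv ℝ F y w) := by
    intro y hy v w
    have hq : (extChartAt 𝓘(ℝ, E) (f p)).symm (F y) = f ((extChartAt 𝓘(ℝ, E) p).symm y) :=
      (extChartAt 𝓘(ℂ, E) (f p)).left_inv hy.2
    rw [localMetric_apply, localMetric_apply, ← mfderiv_chartDeriv hf hy,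
      ← mfderiv_chartDeriv hf hy, hq]
    exact (hc _ _ _).symm
  have hG : ∀ y ∈ V, HasFDerivAt (localMetric g p) (fderiv ℝ (localMetric g p) y) y :=
    fun y hy => (differentiableAt_localMetric hy.1).hasFDerivAt
  have hH : ∀ y ∈ V, HasFDerivAt (localMetric g (f p)) (fderiv ℝ (localMetric g (f p)) (F y))
      (F y) := fun y hy => (differentiableAt_localMetric (hFm y hy)).hasFDerivAt
  have hF1 : ∀ y ∈ V, HasFDerivAt F (fderiv ℝ F y) y := fun y hy =>
    ((contDiffAt_localMap hf hy).differentiableAt (by simp)).hasFDerivAt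
  have hF2 : ∀ y ∈ V, HasFDerivAt (fderiv ℝ F) (fderiv ℝ (fderiv ℝ F) y) y := fun y hy =>
    (((contDiffAt_localMap hf hy).fderiv_right (m := ∞) (by simp)).differentiableAt
      (by simp)).hasFDerivAt
  have hk := fun (y v : E) => hasFDerivAt_const (𝕜 := ℝ) v y
  have hR := fun (y : E) (hy : y ∈ V) (v w : E) =>
    (((hH y hy).comp y (hF1 y hy)).clm_apply ((hF2 y hy).clm_apply (hk y v))).clm_apply
      ((hF2 y hy).clm_apply (hk y w))
  -- `L` is smooth, being a quotient of the two sides evaluated on a fixed vector `e ≠ 0`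
  have hLd : ∀ y ∈ V, DifferentiableAt ℝ L y := by
    intro y hy
    have h1 : DifferentiableAt ℝ (fun z => localMetric g (f p) (F z) (fderiv ℝ F z e)
        (fderiv ℝ F z e) * (localMetric g p z e e)⁻¹) y :=
      (hR y hy e e).differentiableAt.mul
        ((differentiableAt_inv ((isHermitianForm_localMetric hg p hy.1).pos e he).ne').comp y
          (((hG y hy).clm_apply (hk y e)).clm_apply (hk y e)).differentiableAt)
    refine h1.congr_of_eventuallyEq ?_
    filter_upwards [hVo.mem_nhds hy] with z hz
    rw [← hconf z hz, mul_inv_cancel_right₀]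
    exact ((isHermitianForm_localMetric hg p hz.1).pos e he).ne'
  -- the derivative of the conformality relation
  have hder : ∀ y ∈ V, ∀ u v w, fderiv ℝ L y u * localMetric g p y v w
      + L y * fderiv ℝ (localMetric g p) y u v w =
      fderiv ℝ (localMetric g (f p)) (F y) (fderiv ℝ F y u) (fderiv ℝ F y v) (fderiv ℝ F y w)
      + localMetric g (f p) (F y) (fderiv ℝ (fderiv ℝ F) y u v) (fderiv ℝ F y w)
      + localMetric g (f p) (F y) (fderiv ℝ F y v) (fderiv ℝ (fderiv ℝ F) y u w) := by
    intro y hy u v w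
    have h1 := (hLd y hy).hasFDerivAt.mul (((hG y hy).clm_apply (hk y v)).clm_apply (hk y w))
    have h2 := h1.congr_of_eventuallyEq (f₁ := fun z => localMetric g (f p) (F z) (fderiv ℝ F z v)
      (fderiv ℝ F z w)) (by
        filter_upwards [hVo.mem_nhds hy] with z hz
        exact (hconf z hz v w).symm)
    have := congrArg (fun A => A u) (h2.unique (hR y hy v w))
    simp at this
    linarith
  have hzero : V.EqOn (fderiv ℝ L) 0 := by
    intro y hy
    have hm := isHermitianForm_localMetric hg p hy.1
    have hm' := isHermitianForm_localMetric hg (f p) (hFm y hy)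
    refine hm.eq_zero_of_wedge_eq_zero hdim fun u v w => ?_
    have d1 := hder y hy u (cJ E v) w
    have d2 := hder y hy v (cJ E w) u
    have d3 := hder y hy w (cJ E u) v
    have c1 := hg.closed p y hy.1 u v w
    have c2 := hg.closed (f p) (F y) (hFm y hy) (fderiv ℝ F y u) (fderiv ℝ F y v) (fderiv ℝ F y w)
    have J1 := fderiv_localMap_J hf hy
    have J2 := fderiv_fderiv_localMap_J hf hy
    rw [← hF] at J1 J2
    have S : ∀ a b, fderiv ℝ (fderiv ℝ F) y a b = fderiv ℝ (fderiv ℝ F) y b a :=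
      (contDiffAt_localMap hf hy).isSymmSndFDerivAt
        (by
          rw [minSmoothness_of_isRCLikeNormedField]
          exact WithTop.coe_le_coe.2 (le_top (a := (2 : ℕ∞))))
    have A : ∀ a b, localMetric g (f p) (F y) (cJ E a) b
        = -localMetric g (f p) (F y) (cJ E b) a := fun a b => by rw [hm'.J_left, hm'.symm]
    rw [J1, J2] at d1 d2 d3
    rw [S v u, A (fderiv ℝ F y w)] at d2
    rw [S w u, S w v, A (fderiv ℝ F y u)] at d3
    rw [A (fderiv ℝ F y v)] at d1
    -- in the cyclic sum, the second derivatives of `F` cancel by symmetry and both `dω` vanish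
    linear_combination d1 + d2 + d3 + c2 - L y * c1
  obtain ⟨r, hr, hball⟩ := Metric.isOpen_iff.1 hVo _ (mem_localDomain f p)
  have hconst : ∀ y ∈ Metric.ball (extChartAt 𝓘(ℂ, E) p p) r, L y = L (extChartAt 𝓘(ℂ, E) p p) :=
    fun y hy => Metric.isOpen_ball.is_const_of_fderiv_eq_zero
      (convex_ball _ _).isPreconnected
      (fun z hz => (hLd z (hball hz)).differentiableWithinAt)
      (fun z hz => hzero (hball hz)) hy (Metric.mem_ball_self hr)
  filter_upwards [(continuousAt_extChartAt (I := 𝓘(ℂ, E)) p).preimage_mem_nhds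
    (Metric.ball_mem_nhds _ hr), extChartAt_source_mem_nhds (I := 𝓘(ℂ, E)) p] with q hq hqs
  have h1 := hconst _ hq
  have h2 : (extChartAt 𝓘(ℝ, E) p).symm (extChartAt 𝓘(ℂ, E) p q) = q :=
    (extChartAt 𝓘(ℂ, E) p).left_inv hqs
  have h3 : (extChartAt 𝓘(ℝ, E) p).symm (extChartAt 𝓘(ℂ, E) p p) = p :=
    extChartAt_to_inv (I := 𝓘(ℂ, E)) p
  simpa only [hL, h2, h3] using h1

/-- A holomorphic immersion preserving a nonzero Bochner tensor is conformal at each point. -/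
theorem exists_conformal_factor (hg : IsKahler g) (hdim : Module.finrank ℝ E = 4)
    (hB : BochnerNonvanishing g) (hpres : PreservesBochner g f) (p : M)
    (hf : MDifferentiableAt 𝓘(ℂ, E) 𝓘(ℂ, E) f p)
    (hinj : Function.Injective (mfderiv 𝓘(ℝ, E) 𝓘(ℝ, E) f p)) :
    ∃ c : ℝ, 0 < c ∧ ∀ v w : E, metricAt g (f p) (mfderiv 𝓘(ℝ, E) 𝓘(ℝ, E) f p v)
      (mfderiv 𝓘(ℝ, E) 𝓘(ℝ, E) f p w) = c * metricAt g p v w := by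
  let A : E →L[ℝ] E := mfderiv 𝓘(ℝ, E) 𝓘(ℝ, E) f p
  have hAJ : ∀ v, A (cJ E v) = cJ E (A v) := (mfderiv_cJ hf).2
  have hA0 : ∀ v, A v = 0 → v = 0 := fun v hv => hinj (hv.trans (map_zero A).symm)
  have hm' := isHermitianForm_metricAt hg (f p)
  let h : E →L[ℝ] E →L[ℝ] ℝ := (metricAt g (f p)).bilinearComp A A
  have hh : IsHermitianForm h :=
    { symm := fun v w => hm'.symm _ _
      pos := fun v hv => hm'.pos _ fun h0 => hv (hA0 v h0)
      inv := fun v w => by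
        change metricAt g (f p) (A (cJ E v)) (A (cJ E w)) = metricAt g (f p) (A v) (A w)
        rw [hAJ, hAJ, hm'.inv] }
  have hp : ∀ x y z, A (bochnerAt g p x y z) = bochnerAt g (f p) (A x) (A y) (A z) := hpres p
  have hskew : ∀ x y z w, h (bochnerAt g p x y z) w = -h (bochnerAt g p x y w) z := by
    intro x y z w
    change metricAt g (f p) (A (bochnerAt g p x y z)) (A w)
      = -metricAt g (f p) (A (bochnerAt g p x y w)) (A z)
    rw [hp, hp, (isKahlerCurvature_bochner hg hdim (f p)).metric_skew]
  rcases (isKahlerCurvature_bochner hg hdim p).proportional_or_eq_zero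
    (isHermitianForm_metricAt hg p) hh hdim hskew (sum_metricAt_bochner hg hdim p) with hc | h0
  · exact hc
  -- the remaining case is `B = 0`
  · obtain ⟨x, y, z, hxyz⟩ := hB p
    exact absurd (h0 x y z) hxyz

end Conformal

end Kahler
end

theorem theorem2p1 {E : Type*} [NormedAddCommGroup E] [NormedSpace ℂ E] [FiniteDimensional ℂ E]
    (hdim : Module.finrank ℝ E = 4)
    {M : Type*} [TopologicalSpace M] [T2Space M] [ConnectedSpace M]
    [ChartedSpace E M] [IsManifold 𝓘(ℂ, E) ω M]
    (g : Kahler.RiemMetric E M) (hg : Kahler.IsKahler g)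
    (hB : Kahler.BochnerNonvanishing g)
    (f : M ≃ₘ^ω⟮𝓘(ℂ, E), 𝓘(ℂ, E)⟯ M)
    (hf : Kahler.PreservesBochner g f) :
    Kahler.IsHomothety g f := by
  have hfs : ContMDiff 𝓘(ℂ, E) 𝓘(ℂ, E) ω f := f.contMDiff
  have hfd : ∀ p, MDifferentiableAt 𝓘(ℂ, E) 𝓘(ℂ, E) f p := fun p =>
    hfs.mdifferentiableAt (by simp)
  have hinj : ∀ p, Function.Injective (mfderiv 𝓘(ℝ, E) 𝓘(ℝ, E) f p) := by
    intro p
    have h1 := (Kahler.mfderiv_cJ (hfd p)).1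
    have h2 := (Kahler.mfderiv_cJ ((f.symm.contMDiff.mdifferentiableAt (by simp) :
      MDifferentiableAt 𝓘(ℂ, E) 𝓘(ℂ, E) f.symm (f p)))).1
    have h3 := mfderiv_comp p h2 h1
    have h4 : f.symm ∘ f = id := funext f.left_inv
    rw [h4, mfderiv_id] at h3
    exact Function.LeftInverse.injective (g := mfderiv 𝓘(ℝ, E) 𝓘(ℝ, E) f.symm (f p))
      fun v => (DFunLike.congr_fun h3 v).symm
  choose c hc0 hc using fun p => Kahler.exists_conformal_factor hg hdim hB hf p (hfd p) (hinj p)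
  have hlc : IsLocallyConstant c := (IsLocallyConstant.iff_eventually_eq c).2
    (Kahler.eventually_conformal_factor_eq hg hdim hfs c hc)
  obtain ⟨p⟩ := (inferInstance : Nonempty M)
  refine ⟨c p, hc0 p, fun q v w => ?_⟩
  rw [← hlc.apply_eq_of_preconnectedSpace q p]
  exact hc q v w
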